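/- Let $\mathbb D$ be the open unit disc. A scalar kernel $K:\mathbb D\times\mathbb D\to\mathbb C$ is called positive definite if it is sesqui-analytic (holomorphic in the first variable and anti-holomorphic in the second) and for all finitely many distinct points $w_1,\dots,w_l\in\mathbb D$ the matrix $(K(w_i,w_j))_{i,j=1}^l$ is positive definite. For a non-negative definite kernel $K:\mathbb D\times\mathbb D\to M_m(\mathbb C)$ let $(\mathcal H,K)$ denote the reproducing kernel Hilbert space of $\mathbb C^m$-valued functions on $\mathbb D$ with kernel $K$, i.e. $K(\cdot,w)\eta\in\mathcal H$ and $\langle f,K(\cdot,w)\eta\rangle=\langle f(w),\eta\rangle$ for $f\in\mathcal H$, $w\in\mathbb D$, $\eta\in\mathbb C^m$, and let $M_z$ be the operator of multiplication by the coordinate function, $(M_zf)(z)=zf(z)$. A scalar positive definite kernel $K$ is called sharp if $M_z$ is bounded on $(\mathcal H,K)$ and $\ker(M_z^*-\overline w)=\mathbb C\,K(\cdot,w)$ for every $w\in\mathbb D$. A bounded operator $T$ on a complex Hilbert space is called weakly homogeneous if $\sigma(T)\subseteq\overline{\mathbb D}$ and, for every biholomorphic automorphism $\varphi(z)=e^{i\theta}\frac{z-a}{1-\overline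 a z}$ ($\theta\in\mathbb R$, $a\in\mathbb D$) of $\mathbb D$, the operator $\varphi(T)$, defined by the holomorphic (Riesz–Dunford) functional calculus, is similar to $T$, i.e. $\varphi(T)=LTL^{-1}$ for some bounded invertible $L$. **Theorem.** Let $K_1$ and $K_2$ be scalar sharp positive definite kernels on $\mathbb D\times\mathbb D$ such that the multiplication operators $M_z$ on $(\mathcal H,K_1)$ and on $(\mathcal H,K_2)$ are weakly homogeneous. Then for every integer $n\ge 0$ the function $$J_n(K_1,K_2)_{|\mathrm{res}\,\Delta}(z,w)=\Big(K_1(z,w)\,\big(\tfrac{\partial}{\partial z}\big)^i\big(\tfrac{\partial}{\partial\overline w}\big)^jK_2(z,w)\Big)_{i,j=0}^n ,\qquad z,w\in\mathbb D,$$ is a non-negative definite $M_{n+1}(\mathbb C)$-valued kernel on $\mathbb D\times\mathbb D$, and the multiplication operator $M_z$ on $\big(\mathcal H,J_n(K_1,K_2)_{|\mathrm{res}\,\Delta}\big)$ is bounded and weakly homogeneous. -/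

import Mathlib

open scoped ComplexConjugate ComplexOrder Complex.UnitDisc

noncomputable section

/-- The biholomorphic automorphism `φ_{θ,a}(z) = e^{iθ} (z - a) / (1 - \bar a z)` of the unit disc
(for `‖a‖ < 1`), as a rational function on the plane. -/
def mobius (θ : ℝ) (a z : ℂ) : ℂ :=
  Complex.exp (θ * Complex.I) * ((z - a) / (1 - conj a * z))

section Operators

variable {H : Type*} [NormedAddCommGroup H] [InnerProductSpace ℂ H]

/-- The Riesz–Dunford functional calculus `f(T) = (2πi)⁻¹ ∮_{|z| = r} f(z) (z - T)⁻¹ dz`,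
for an operator `T` whose spectrum lies in the open disc of radius `r` about `0` and a function
`f` that is holomorphic in a neighbourhood of the closed disc of radius `r`. -/
def dunford (f : ℂ → ℂ) (r : ℝ) (T : H →L[ℂ] H) : H →L[ℂ] H :=
  (2 * Real.pi * Complex.I : ℂ)⁻¹ • ∮ z in C(0, r), f z • resolvent T z

/-- `φ_{θ,a}(T)` for an operator `T` with spectrum in the closed unit disc and `‖a‖ < 1`.
The contour has radius `r = 2 / (1 + ‖a‖)`; then `1 < r` and `r * ‖a‖ < 1`, so the circle
surrounds the closed unit disc and `φ_{θ,a}` has no pole on or inside it. (All radii with these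
two properties give the same operator.) -/
def mobiusOp (θ : ℝ) (a : ℂ) (T : H →L[ℂ] H) : H →L[ℂ] H :=
  dunford (mobius θ a) (2 / (1 + ‖a‖)) T

/-- Two bounded operators are similar if a bounded invertible operator conjugates one into the
other. -/
def SimilarOp (T₁ T₂ : H →L[ℂ] H) : Prop :=
  ∃ L : (H →L[ℂ] H)ˣ, (L : H →L[ℂ] H) * T₁ * ((L⁻¹ : (H →L[ℂ] H)ˣ) : H →L[ℂ] H) = T₂

/-- `T` is weakly homogeneous: its spectrum lies in the closed unit disc and `φ(T)` is similar to
`T` for every automorphism `φ` of the unit disc. -/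
def WeaklyHomogeneous (T : H →L[ℂ] H) : Prop :=
  spectrum ℂ T ⊆ Metric.closedBall 0 1 ∧
    ∀ (θ : ℝ) (a : ℂ), ‖a‖ < 1 → SimilarOp (mobiusOp θ a T) T

end Operators

section FunctionSpaces

variable {V : Type*} [NormedAddCommGroup V] [InnerProductSpace ℂ V]

/-- The bounded operator `T` on the reproducing kernel Hilbert space `H` of `V`-valued functions
on the unit disc is the operator `M_z` of multiplication by the coordinate function. -/
def IsCoordMul {H : Type*} [NormedAddCommGroup H] [InnerProductSpace ℂ H] [RKHS ℂ H 𝔻 V]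
    (T : H →L[ℂ] H) : Prop :=
  ∀ (f : H) (z : 𝔻), (T f) z = (z : ℂ) • f z

variable (H : Type*) [NormedAddCommGroup H] [InnerProductSpace ℂ H] [RKHS ℂ H 𝔻 V]

/-- `M_z` is a bounded operator on `H` and is weakly homogeneous. -/
def CoordMulWeaklyHomogeneous : Prop :=
  ∃ T : H →L[ℂ] H, IsCoordMul T ∧ WeaklyHomogeneous T

/-- Sharpness: `M_z` is bounded on `H` and `ker (M_z^* - \bar w)` is the closed linear span of
the vectors `K(·, w) η`, for every `w` in the disc. -/
def IsSharp [CompleteSpace H] [CompleteSpace V] : Prop :=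
  ∃ T : H →L[ℂ] H, IsCoordMul T ∧
    ∀ w : 𝔻, LinearMap.ker
        ((ContinuousLinearMap.adjoint T - conj (w : ℂ) • ContinuousLinearMap.id ℂ H :
          H →L[ℂ] H) : H →ₗ[ℂ] H) =
      (Submodule.span ℂ (Set.range (RKHS.kerFun H w))).topologicalClosure

end FunctionSpaces

/-! Kernels are functions on `ℂ × ℂ` of which only the values on the disc matter. -/

/-- `K` is sesqui-analytic on the disc: `K(z, w)` is holomorphic in `z` and anti-holomorphic in
`w`, that is, `(z, u) ↦ K(z, \bar u)` is a holomorphic function of two variables. -/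
def SesquiAnalytic (K : ℂ → ℂ → ℂ) : Prop :=
  DifferentiableOn ℂ (fun p : ℂ × ℂ => K p.1 (conj p.2)) (Metric.ball 0 1 ×ˢ Metric.ball 0 1)

/-- `K` is a (strictly) positive definite scalar kernel on the disc: all matrices
`(K(w_i, w_j))` for finitely many distinct points are positive definite. -/
def PosDefKernel (K : ℂ → ℂ → ℂ) : Prop :=
  (Matrix.of fun z w : 𝔻 => K z w).PosDef

/-- `H` is the Hilbert space `(H, K)` of scalar functions on the disc with reproducing
kernel `K`. -/
def HasScalarKernel (H : Type*) [NormedAddCommGroup H] [InnerProductSpace ℂ H] [CompleteSpace H]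
    [RKHS ℂ H 𝔻 ℂ] (K : ℂ → ℂ → ℂ) : Prop :=
  ∀ z w : 𝔻, RKHS.kernel H z w = K z w • ContinuousLinearMap.id ℂ ℂ

/-- `H` is the Hilbert space `(H, K)` of `ℂ^m`-valued functions on the disc with
reproducing kernel `K`. -/
def HasMatrixKernel {m : ℕ} (H : Type*) [NormedAddCommGroup H] [InnerProductSpace ℂ H]
    [CompleteSpace H] [RKHS ℂ H 𝔻 (EuclideanSpace ℂ (Fin m))]
    (K : ℂ → ℂ → Matrix (Fin m) (Fin m) ℂ) : Prop :=
  ∀ z w : 𝔻, RKHS.kernel H z w = Matrix.toEuclideanCLM (𝕜 := ℂ) (K z w)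

/-- A matrix-valued kernel is non-negative definite on the disc: the block matrices
`(K(w_i, w_j))` are positive semidefinite. -/
def NonnegDefKernel {m : ℕ} (K : ℂ → ℂ → Matrix (Fin m) (Fin m) ℂ) : Prop :=
  (Matrix.of fun p q : 𝔻 × Fin m => K p.1 q.1 p.2 q.2).PosSemidef

/-- The `j`-th derivative `(∂/∂\bar w)^j F` of an anti-holomorphic function `F`. -/
def antiDeriv (j : ℕ) (F : ℂ → ℂ) (w : ℂ) : ℂ :=
  conj (iteratedDeriv j (fun u => conj (F u)) w)

/-- The jet kernel
`J_n(K₁, K₂)|_{res Δ}(z, w) = (K₁(z, w) (∂/∂z)^i (∂/∂\bar w)^j K₂(z, w))_{i, j = 0}^n`. -/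
def jetKernel (n : ℕ) (K₁ K₂ : ℂ → ℂ → ℂ) (z w : ℂ) : Matrix (Fin (n + 1)) (Fin (n + 1)) ℂ :=
  Matrix.of fun i j => K₁ z w * iteratedDeriv i (fun x => antiDeriv j (K₂ x) w) z

end

/-! Write `k₁ z` for the kernel vector of `H₁` and `e z i` for the vector of `H₂` representing `f ↦
f^{(i)}(z)`. The jet kernel is `⟪k₁ z, k₁ w⟫ * ⟪e z i, e w j⟫`, a Schur product of Gram matrices;
this gives non-negativity. It also identifies the kernel vectors of the jet space with the tensors
`k₁ z ⊗ e z i`.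

Let `φ` be an automorphism of the disc. The adjoint of an operator intertwining `M_z` and `φ(M_z)`
maps `ker (M_z^* - \bar w)` into `ker (M_z^* - \overline{φ(w)})`. By sharpness these are lines, so
it sends `k w` to a nonzero multiple of `k (φ w)` (`HasScalarKernel.exists_weight`). Its own adjoint
is `f ↦ g · f ∘ φ` with `g` holomorphic and zero-free. Differentiation shows that on `H₂` the jets
at `w` go to jets at `φ w` by a triangular matrix with diagonal `g (φ')^i`, hence invertible
(`HasScalarKernel.exists_jet_weight`).

So `S₁ ⊗ S₂` preserves the closed span of the vectors `k₁ z ⊗ e z i`, as does its inverse. No tensor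
product is formed: the Schur product theorem bounds the induced operator directly
(`exists_clm_of_gram_hadamard`, `exists_clm_transport_unit`). The adjoint of the induced operator is
a matrix-weighted composition with `φ`, which intertwines `M_z` and `φ(M_z)` on the jet space.
Multipliers of `H₁` transfer in the same way, which gives boundedness of `M_z` and control of its
spectrum. -/

open scoped InnerProductSpace

noncomputable section

/-! ### Gram matrices, Schur products and bounded operators -/

section Gram

variable {P E F H : Type*} [NormedAddCommGroup E] [InnerProductSpace ℂ E]
  [NormedAddCommGroup F] [InnerProductSpace ℂ F] [NormedAddCommGroup H] [InnerProductSpace ℂ H]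

lemma finsuppSum_gram (v : P → E) (x : P →₀ ℂ) :
    (x.sum fun i xi => x.sum fun j xj => star xi * Matrix.gram ℂ v i j * xj) =
      ⟪Finsupp.linearCombination ℂ v x, Finsupp.linearCombination ℂ v x⟫_ℂ := by
  simp only [Finsupp.linearCombination_apply, Finsupp.sum_inner, Finsupp.inner_sum,
    inner_smul_left, inner_smul_right, Matrix.gram_apply]
  simp only [Finsupp.sum, Finset.mul_sum]
  rw [Finset.sum_comm]
  refine Finset.sum_congr rfl fun i _ => Finset.sum_congr rfl fun j _ => ?_
  rw [starRingEnd_apply]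
  ring

/-- Gram matrices of arbitrary, possibly infinite, families are positive semidefinite. -/
lemma gram_posSemidef (v : P → E) : (Matrix.gram ℂ v).PosSemidef := by
  refine ⟨Matrix.isHermitian_gram ℂ v, fun x => ?_⟩
  rw [finsuppSum_gram, inner_self_eq_norm_sq_to_K]
  exact mod_cast RCLike.ofReal_nonneg.2 (sq_nonneg ‖Finsupp.linearCombination ℂ v x‖)

lemma finsuppSum_smul_gram_sub_gram (C : ℝ) (v : P → E) (v' : P → F) (x : P →₀ ℂ) :
    (x.sum fun i xi => x.sum fun j xj =>
        star xi * ((C : ℂ) • Matrix.gram ℂ v - Matrix.gram ℂ v') i j * xj) =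
      ((C * ‖Finsupp.linearCombination ℂ v x‖ ^ 2 -
        ‖Finsupp.linearCombination ℂ v' x‖ ^ 2 : ℝ) : ℂ) := by
  have h1 := finsuppSum_gram v x
  have h2 := finsuppSum_gram v' x
  rw [inner_self_eq_norm_sq_to_K] at h1 h2
  push_cast
  erw [← h1, ← h2]
  simp only [Finsupp.sum, Finset.mul_sum, ← Finset.sum_sub_distrib]
  refine Finset.sum_congr rfl fun i _ => Finset.sum_congr rfl fun j _ => ?_
  simp only [Matrix.sub_apply, Matrix.smul_apply, smul_eq_mul]
  ring

lemma smul_gram_sub_gram_isHermitian (C : ℝ) (v : P → E) (v' : P → F) :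
    ((C : ℂ) • Matrix.gram ℂ v - Matrix.gram ℂ v').IsHermitian := by
  ext i j
  simp [Matrix.gram_apply]

/-- With `y = ∑ x p • v p`, the quadratic form at `x` is `‖S‖² ‖y‖² - ‖S y‖²`. -/
lemma smul_gram_sub_gram_map_posSemidef (S : E →L[ℂ] F) (v : P → E) :
    (((‖S‖ ^ 2 : ℝ) : ℂ) • Matrix.gram ℂ v - Matrix.gram ℂ fun p => S (v p)).PosSemidef := by
  refine ⟨smul_gram_sub_gram_isHermitian _ _ _, fun x => ?_⟩
  rw [finsuppSum_smul_gram_sub_gram]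
  have h : Finsupp.linearCombination ℂ (fun p => S (v p)) x =
      S (Finsupp.linearCombination ℂ v x) := by
    simp [Finsupp.linearCombination_apply, Finsupp.sum, map_sum]
  rw [h]
  have := S.le_opNorm (Finsupp.linearCombination ℂ v x)
  rw [← mul_pow]
  exact_mod_cast sub_nonneg.2 (pow_le_pow_left₀ (norm_nonneg _) this 2)

/-- Domination of Gram matrices says `‖∑ x p • v' p‖ ≤ √C ‖∑ x p • v p‖`. Hence `v p ↦ v' p` is well
defined and bounded on the dense span of `v`, and extends by continuity. -/
lemma exists_clm_of_gram_le [CompleteSpace F] {C : ℝ} (hC : 0 ≤ C) {v : P → E} {v' : P → F}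
    (hv : (Submodule.span ℂ (Set.range v)).topologicalClosure = ⊤)
    (h : ((C : ℂ) • Matrix.gram ℂ v - Matrix.gram ℂ v').PosSemidef) :
    ∃ S : E →L[ℂ] F, ∀ p, S (v p) = v' p := by
  have hdense : DenseRange (Finsupp.linearCombination ℂ v) := by
    rw [DenseRange, ← LinearMap.coe_range, Finsupp.range_linearCombination]
    exact Submodule.dense_iff_topologicalClosure_eq_top.2 hv
  have hle : ∀ x, ‖Finsupp.linearCombination ℂ v' x‖ ≤
      Real.sqrt C * ‖Finsupp.linearCombination ℂ v x‖ := fun x => by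
    have hx := h.2 x
    rw [finsuppSum_smul_gram_sub_gram] at hx
    have hx' : 0 ≤ C * ‖Finsupp.linearCombination ℂ v x‖ ^ 2 -
        ‖Finsupp.linearCombination ℂ v' x‖ ^ 2 := by exact_mod_cast hx
    refine le_of_sq_le_sq ?_ (by positivity)
    rw [mul_pow, Real.sq_sqrt hC]
    linarith
  refine ⟨(Finsupp.linearCombination ℂ v').extendOfNorm (Finsupp.linearCombination ℂ v),
    fun p => ?_⟩
  have := LinearMap.extendOfNorm_eq hdense ⟨_, hle⟩ (Finsupp.single p 1)
  simpa using this

/-- If the Gram matrix of `k` is the Schur product of those of `k₁` and `k₂`, then a pair of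
bounded operators acting on `k₁` and `k₂` induces a bounded operator acting on `k`. -/
lemma exists_clm_of_gram_hadamard [CompleteSpace H] {k k' : P → H} {k₁ : P → E} {k₂ : P → F}
    (hdense : (Submodule.span ℂ (Set.range k)).topologicalClosure = ⊤)
    (hk : ∀ p q, ⟪k p, k q⟫_ℂ = ⟪k₁ p, k₁ q⟫_ℂ * ⟪k₂ p, k₂ q⟫_ℂ)
    (S₁ : E →L[ℂ] E) (S₂ : F →L[ℂ] F)
    (hk' : ∀ p q, ⟪k' p, k' q⟫_ℂ = ⟪S₁ (k₁ p), S₁ (k₁ q)⟫_ℂ * ⟪S₂ (k₂ p), S₂ (k₂ q)⟫_ℂ) :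
    ∃ S : H →L[ℂ] H, ∀ p, S (k p) = k' p := by
  refine exists_clm_of_gram_le (C := ‖S₁‖ ^ 2 * ‖S₂‖ ^ 2) (by positivity) hdense ?_
  -- With `Cᵢ = ‖Sᵢ‖²` and primes for the transformed Gram matrices, `C₁C₂ G₁∘G₂ - G₁'∘G₂' = (C₁G₁ -
  -- G₁')∘G₂' + C₁ G₁∘(C₂G₂ - G₂')`, and both summands are positive semidefinite by the Schur
  -- product theorem.
  have h1 := (smul_gram_sub_gram_map_posSemidef S₁ k₁).hadamard
    (gram_posSemidef fun p => S₂ (k₂ p))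
  have h2 := (gram_posSemidef k₁).hadamard (smul_gram_sub_gram_map_posSemidef S₂ k₂)
  have h3 := h1.add (h2.smul (a := ((‖S₁‖ ^ 2 : ℝ) : ℂ)) (by exact_mod_cast sq_nonneg ‖S₁‖))
  convert! h3 using 1
  ext p q
  simp only [Matrix.sub_apply, Matrix.smul_apply, Matrix.add_apply, Matrix.hadamard_apply,
    Matrix.gram_apply, smul_eq_mul, hk, hk']
  push_cast
  ring

lemma gram_hadamard_posSemidef (k₁ : P → E) (k₂ : P → F) :
    (Matrix.of fun p q => ⟪k₁ p, k₁ q⟫_ℂ * ⟪k₂ p, k₂ q⟫_ℂ).PosSemidef :=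
  (gram_posSemidef k₁).hadamard (gram_posSemidef k₂)

end Gram

/-- Extension by zero of a function on the disc to the plane. -/
def discExt (f : 𝔻 → ℂ) (z : ℂ) : ℂ :=
  if h : ‖z‖ < 1 then f (Complex.UnitDisc.mk z h) else 0

@[simp]
lemma discExt_coe (f : 𝔻 → ℂ) (z : 𝔻) : discExt f z = f z := by
  simp [discExt, z.norm_lt_one]

lemma discExt_mk (f : 𝔻 → ℂ) {z : ℂ} (hz : ‖z‖ < 1) :
    discExt f z = f (Complex.UnitDisc.mk z hz) := by
  simp [discExt, hz]

lemma discExt_add (f g : 𝔻 → ℂ) : discExt (f + g) = discExt f + discExt g := by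
  ext z
  by_cases h : ‖z‖ < 1 <;> simp [discExt, h]

lemma discExt_smul (c : ℂ) (f : 𝔻 → ℂ) : discExt (c • f) = c • discExt f := by
  ext z
  by_cases h : ‖z‖ < 1 <;> simp [discExt, h]

lemma Complex.UnitDisc.coe_mem_ball (z : 𝔻) : (z : ℂ) ∈ Metric.ball (0 : ℂ) 1 :=
  mem_ball_zero_iff.2 z.norm_lt_one

lemma Complex.UnitDisc.ball_mem_nhds (z : 𝔻) : Metric.ball (0 : ℂ) 1 ∈ nhds (z : ℂ) :=
  Metric.isOpen_ball.mem_nhds z.coe_mem_ball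

/-! ### Holomorphy and derivative evaluations in a scalar kernel space -/

section ScalarKernel

variable {K : ℂ → ℂ → ℂ} {H : Type*} [NormedAddCommGroup H] [InnerProductSpace ℂ H]
  [CompleteSpace H] [RKHS ℂ H 𝔻 ℂ]

lemma HasScalarKernel.kerFun_apply (hker : HasScalarKernel H K) (w z : 𝔻) (c : ℂ) :
    RKHS.kerFun H w c z = K z w * c := by
  rw [RKHS.kerFun_apply, hker]
  simp

lemma HasScalarKernel.norm_apply_le (hker : HasScalarKernel H K) (f : H) (z : 𝔻) :
    ‖f z‖ ≤ ‖f‖ * √‖K z z‖ := by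
  refine (RKHS.norm_apply_le f z).trans ?_
  rw [hker, norm_smul]
  gcongr
  simp

lemma SesquiAnalytic.continuousOn_diag (hK : SesquiAnalytic K) :
    ContinuousOn (fun z => K z z) (Metric.ball 0 1) := by
  have h : Continuous fun z : ℂ => (z, conj z) := by fun_prop
  have := hK.continuousOn.comp (f := fun z : ℂ => (z, conj z)) (s := Metric.ball 0 1)
    h.continuousOn (fun z hz => by simpa using hz)
  simpa [Function.comp_def] using this

lemma SesquiAnalytic.differentiableOn_left (hK : SesquiAnalytic K) (w : 𝔻) :
    DifferentiableOn ℂ (fun z => K z w) (Metric.ball 0 1) := by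
  have h : Differentiable ℂ fun z : ℂ => (z, conj (w : ℂ)) := by fun_prop
  have := hK.comp (f := fun z : ℂ => (z, conj (w : ℂ))) (s := Metric.ball 0 1)
    h.differentiableOn (fun z hz => by simpa [w.norm_lt_one] using hz)
  simpa [Function.comp_def] using this

/-- Near every point of the disc the evaluations are uniformly bounded functionals. -/
lemma HasScalarKernel.exists_local_bound (hK : SesquiAnalytic K) (hker : HasScalarKernel H K)
    {w : ℂ} (hw : w ∈ Metric.ball (0 : ℂ) 1) :
    ∃ C : ℝ, 0 < C ∧ ∀ᶠ z in nhds w, ∀ f : H, ‖discExt f z‖ ≤ C * ‖f‖ := by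
  have hcont := (hK.continuousOn_diag.continuousAt (Metric.isOpen_ball.mem_nhds hw)).norm.sqrt
  refine ⟨√‖K w w‖ + 1, by positivity, ?_⟩
  filter_upwards [hcont.eventually_lt_const (lt_add_one _), Metric.isOpen_ball.mem_nhds hw]
    with z hz hz1 f
  have hz1' : ‖z‖ < 1 := mem_ball_zero_iff.1 hz1
  rw [discExt_mk f hz1', mul_comm]
  refine (hker.norm_apply_le f _).trans ?_
  gcongr
  exact hz.le

/-- Kernel functions are holomorphic and span a dense subspace; local boundedness of evaluations
turns norm convergence into locally uniform convergence, which preserves holomorphy. -/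
lemma HasScalarKernel.differentiableOn (hK : SesquiAnalytic K) (hker : HasScalarKernel H K)
    (f : H) : DifferentiableOn ℂ (discExt f) (Metric.ball 0 1) := by
  let M : Submodule ℂ H :=
    { carrier := {f | DifferentiableOn ℂ (discExt f) (Metric.ball 0 1)}
      add_mem' := fun {f g} hf hg => by
        simp only [Set.mem_ofPred_eq, RKHS.coe_add, discExt_add] at *
        exact hf.add hg
      zero_mem' := by
        have : discExt (⇑(0 : H)) = fun _ => 0 := by
          ext z
          simp [discExt]
        simp only [Set.mem_ofPred_eq, this]
        exact differentiableOn_const 0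
      smul_mem' := fun c f hf => by
        simp only [Set.mem_ofPred_eq, RKHS.coe_smul, discExt_smul] at *
        exact hf.const_smul c }
  have hM : Submodule.span ℂ {RKHS.kerFun H x v | (x) (v)} ≤ M := by
    rw [Submodule.span_le]
    rintro _ ⟨w, c, rfl⟩
    refine ((hK.differentiableOn_left w).mul_const c).congr fun z hz => ?_
    rw [discExt_mk _ (mem_ball_zero_iff.1 hz), hker.kerFun_apply]
    rfl
  have hf : f ∈ (Submodule.span ℂ {RKHS.kerFun H x v | (x) (v)}).topologicalClosure := by
    rw [RKHS.kerFun_dense]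
    trivial
  obtain ⟨F, hF, hlim⟩ := mem_closure_iff_seq_limit.1 hf
  have hunif : TendstoLocallyUniformlyOn (fun n => discExt (F n)) (discExt f) Filter.atTop
      (Metric.ball 0 1) := by
    rw [Metric.tendstoLocallyUniformlyOn_iff]
    intro ε hε w hw
    obtain ⟨C, hC, hbound⟩ := hker.exists_local_bound hK hw
    refine ⟨_, mem_nhdsWithin_of_mem_nhds hbound, ?_⟩
    have h0 := tendsto_iff_norm_sub_tendsto_zero.1 hlim
    filter_upwards [h0.eventually_lt_const (div_pos hε hC)] with n hn z hz
    have hsub : discExt f z - discExt (F n) z = discExt (⇑(f - F n)) z := by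
      by_cases h : ‖z‖ < 1 <;> simp [discExt, h]
    rw [dist_eq_norm, hsub]
    refine (hz (f - F n)).trans_lt ?_
    rwa [norm_sub_rev, ← lt_div_iff₀' hC]
  exact hunif.differentiableOn (.of_forall fun n => hM (hF n)) Metric.isOpen_ball

lemma HasScalarKernel.contDiffAt (hK : SesquiAnalytic K) (hker : HasScalarKernel H K)
    (f : H) (w : 𝔻) (j : ℕ) : ContDiffAt ℂ j (discExt f) w :=
  ((hker.differentiableOn hK f).analyticAt w.ball_mem_nhds).contDiffAt

/-- The functional `f ↦ f^{(j)}(w)` is bounded, hence represented by a vector. -/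
lemma HasScalarKernel.exists_inner_eq_iteratedDeriv (hK : SesquiAnalytic K)
    (hker : HasScalarKernel H K) (w : 𝔻) (j : ℕ) :
    ∃ e : H, ∀ f : H, ⟪e, f⟫_ℂ = iteratedDeriv j (discExt f) w := by
  obtain ⟨C, hC, hbound⟩ := hker.exists_local_bound hK w.coe_mem_ball
  obtain ⟨R, hR, hball⟩ := Metric.nhds_basis_closedBall.mem_iff.1
    (Filter.inter_mem hbound w.ball_mem_nhds)
  let ℓ : H →ₗ[ℂ] ℂ :=
    { toFun := fun f => iteratedDeriv j (discExt f) w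
      map_add' := fun f g => by
        rw [RKHS.coe_add, discExt_add]
        exact iteratedDeriv_add (hker.contDiffAt hK f w j) (hker.contDiffAt hK g w j)
      map_smul' := fun c f => by
        rw [RKHS.coe_smul, discExt_smul]
        exact iteratedDeriv_const_smul_field c _ }
  -- Cauchy's estimate on a disc of radius `R` on which evaluations are bounded by `C`.
  have hℓ : ∀ f, ‖ℓ f‖ ≤ (j.factorial * C / R ^ j) * ‖f‖ := fun f => by
    have hd : DiffContOnCl ℂ (discExt f) (Metric.ball (w : ℂ) R) :=
      ((hker.differentiableOn hK f).mono fun z hz =>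
        (hball (Metric.closure_ball_subset_closedBall hz)).2).diffContOnCl
    refine (Complex.norm_iteratedDeriv_le_of_forall_mem_sphere_norm_le j hR hd
      (C := C * ‖f‖) fun z hz => (hball (Metric.sphere_subset_closedBall hz)).1 f).trans_eq ?_
    ring
  refine ⟨(InnerProductSpace.toDual ℂ H).symm (ℓ.mkContinuous _ hℓ), fun f => ?_⟩
  simp [ℓ]

lemma HasScalarKernel.conj_symm (hker : HasScalarKernel H K) (z w : 𝔻) :
    conj (K z w) = K w z := by
  have h := RKHS.kernel_inner H z w (1 : ℂ) (1 : ℂ)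
  rw [hker] at h
  have h' := RKHS.kerFun_inner (H := H) w (1 : ℂ) (RKHS.kerFun H z 1)
  rw [hker.kerFun_apply] at h'
  rw [h'] at h
  simpa using h

/-- By the reproducing property `e w j` is, as a function of `x`, the conjugate of the `j`-th
derivative of the kernel function at `x`, that is `(∂/∂\bar w)^j K(x, w)`. Pairing with `e z i` then
differentiates in `x`. -/
lemma HasScalarKernel.iteratedDeriv_antiDeriv (hker : HasScalarKernel H K) {e : 𝔻 → ℕ → H}
    (he : ∀ w j (f : H), ⟪e w j, f⟫_ℂ = iteratedDeriv j (discExt f) w) (z w : 𝔻) (i j : ℕ) :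
    iteratedDeriv i (fun x => antiDeriv j (K x) w) z = ⟪e z i, e w j⟫_ℂ := by
  rw [he]
  refine Filter.EventuallyEq.iteratedDeriv_eq i ?_
  filter_upwards [z.ball_mem_nhds] with x hx
  lift x to 𝔻 using mem_ball_zero_iff.1 hx
  have h1 : ⟪RKHS.kerFun H x 1, e w j⟫_ℂ = e w j x := by simp
  rw [discExt_coe, ← h1, ← inner_conj_symm, he, antiDeriv]
  congr 1
  refine Filter.EventuallyEq.iteratedDeriv_eq j ?_
  filter_upwards [w.ball_mem_nhds] with u hu
  lift u to 𝔻 using mem_ball_zero_iff.1 hu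
  rw [discExt_coe, hker.kerFun_apply, hker.conj_symm, mul_one]

end ScalarKernel

/-- The coefficients `a i k` in
`(d/dz)^i (g · f ∘ φ) = ∑ k ≤ i, a i k · f^{(k)} ∘ φ`. -/
def jetCoeff (g φ : ℂ → ℂ) : ℕ → ℕ → ℂ → ℂ
  | 0, 0 => g
  | 0, _ + 1 => 0
  | i + 1, 0 => deriv (jetCoeff g φ i 0)
  | i + 1, k + 1 => fun z => deriv (jetCoeff g φ i (k + 1)) z + jetCoeff g φ i k z * deriv φ z

/-! ### Action of weighted composition on jets -/

section JetCoeff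

variable {g φ : ℂ → ℂ}

lemma jetCoeff_of_lt {i k : ℕ} (h : i < k) : jetCoeff g φ i k = 0 := by
  induction i generalizing k with
  | zero =>
    obtain ⟨k, rfl⟩ := Nat.exists_eq_succ_of_ne_zero h.ne'
    rfl
  | succ i ih =>
    obtain ⟨k, rfl⟩ := Nat.exists_eq_succ_of_ne_zero (Nat.ne_zero_of_lt h)
    ext z
    simp [jetCoeff, ih (show i < k + 1 by omega), ih (show i < k by omega)]

lemma jetCoeff_self (i : ℕ) (z : ℂ) : jetCoeff g φ i i z = g z * deriv φ z ^ i := by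
  induction i with
  | zero => simp [jetCoeff]
  | succ i ih => simp [jetCoeff, jetCoeff_of_lt (show i < i + 1 by omega), ih, pow_succ, mul_assoc]

variable {U : Set ℂ}

lemma differentiableOn_jetCoeff (hU : IsOpen U) (hg : DifferentiableOn ℂ g U)
    (hφ : DifferentiableOn ℂ φ U) (i k : ℕ) : DifferentiableOn ℂ (jetCoeff g φ i k) U := by
  induction i generalizing k with
  | zero =>
    cases k with
    | zero => exact hg
    | succ k => exact differentiableOn_const 0
  | succ i ih =>
    cases k with
    | zero => exact (ih 0).deriv hU
    | succ k => exact ((ih (k + 1)).deriv hU).add ((ih k).mul (hφ.deriv hU))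

lemma DifferentiableOn.iteratedDeriv_of_isOpen {f : ℂ → ℂ} (hU : IsOpen U)
    (hf : DifferentiableOn ℂ f U) (k : ℕ) : DifferentiableOn ℂ (iteratedDeriv k f) U := by
  induction k with
  | zero => simpa using hf
  | succ k ih =>
    rw [iteratedDeriv_succ]
    exact ih.deriv hU

lemma iteratedDeriv_mul_comp {f : ℂ → ℂ} (hU : IsOpen U) (hg : DifferentiableOn ℂ g U)
    (hφ : DifferentiableOn ℂ φ U) (hmaps : Set.MapsTo φ U U) (hf : DifferentiableOn ℂ f U)
    (i : ℕ) {z : ℂ} (hz : z ∈ U) :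
    iteratedDeriv i (fun x => g x * f (φ x)) z =
      ∑ k ∈ Finset.range (i + 1), jetCoeff g φ i k z * iteratedDeriv k f (φ z) := by
  induction i generalizing z with
  | zero => simp [jetCoeff]
  | succ i ih =>
    have heq : iteratedDeriv i (fun x => g x * f (φ x)) =ᶠ[nhds z] fun z =>
        ∑ k ∈ Finset.range (i + 1), jetCoeff g φ i k z * iteratedDeriv k f (φ z) := by
      filter_upwards [hU.mem_nhds hz] with x hx using ih hx
    have hterm : ∀ k, HasDerivAt (fun x => jetCoeff g φ i k x * iteratedDeriv k f (φ x))
        (deriv (jetCoeff g φ i k) z * iteratedDeriv k f (φ z) +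
          jetCoeff g φ i k z * (iteratedDeriv (k + 1) f (φ z) * deriv φ z)) z := fun k => by
      have h1 := ((differentiableOn_jetCoeff hU hg hφ i k).differentiableAt
        (hU.mem_nhds hz)).hasDerivAt
      have h2 := ((hf.iteratedDeriv_of_isOpen hU k).differentiableAt
        (hU.mem_nhds (hmaps hz))).hasDerivAt
      rw [← iteratedDeriv_succ] at h2
      exact h1.mul (h2.comp z (hφ.differentiableAt (hU.mem_nhds hz)).hasDerivAt)
    rw [iteratedDeriv_succ, heq.deriv_eq, (HasDerivAt.fun_sum fun k _ => hterm k).deriv,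
      Finset.sum_add_distrib, Finset.sum_range_succ' _ (i + 1)]
    have hlast : deriv (jetCoeff g φ i (i + 1)) z = 0 := by
      rw [jetCoeff_of_lt (Nat.lt_succ_self i)]
      exact deriv_const z 0
    -- The added top term has coefficient zero, so the sum can be reindexed to match the shifted one
    -- from `φ'`.
    have hshift : ∑ k ∈ Finset.range (i + 1),
        deriv (jetCoeff g φ i k) z * iteratedDeriv k f (φ z) =
        ∑ k ∈ Finset.range (i + 1),
          deriv (jetCoeff g φ i (k + 1)) z * iteratedDeriv (k + 1) f (φ z) +
          deriv (jetCoeff g φ i 0) z * iteratedDeriv 0 f (φ z) := by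
      rw [← Finset.sum_range_succ' (fun k => deriv (jetCoeff g φ i k) z *
        iteratedDeriv k f (φ z)) (i + 1), Finset.sum_range_succ _ (i + 1), hlast, zero_mul,
        add_zero]
    rw [hshift, add_right_comm, ← Finset.sum_add_distrib]
    congr 1
    refine Finset.sum_congr rfl fun k _ => ?_
    simp only [jetCoeff]
    ring

/-- The matrix by which `f ↦ g · f ∘ φ` acts on `n`-jets. -/
def jetMatrix (g φ : ℂ → ℂ) (n : ℕ) (z : ℂ) : Matrix (Fin (n + 1)) (Fin (n + 1)) ℂ :=
  Matrix.of fun i k => jetCoeff g φ i k z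

lemma isUnit_det_jetMatrix {z : ℂ} (hg : g z ≠ 0) (hφ : deriv φ z ≠ 0) (n : ℕ) :
    IsUnit (jetMatrix g φ n z).det := by
  rw [Matrix.det_of_isLowerTriangular, isUnit_iff_ne_zero, Finset.prod_ne_zero_iff]
  · intro i _
    simp [jetMatrix, jetCoeff_self, hg, hφ]
  · intro i k hik
    simp only [jetMatrix, Matrix.of_apply]
    rw [jetCoeff_of_lt (by simpa using hik)]
    rfl

lemma iteratedDeriv_mul_comp_eq_jetMatrix {f : ℂ → ℂ} (hU : IsOpen U)
    (hg : DifferentiableOn ℂ g U) (hφ : DifferentiableOn ℂ φ U) (hmaps : Set.MapsTo φ U U)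
    (hf : DifferentiableOn ℂ f U) {n : ℕ} (i : Fin (n + 1)) {z : ℂ} (hz : z ∈ U) :
    iteratedDeriv i (fun x => g x * f (φ x)) z =
      ∑ k, jetMatrix g φ n z i k * iteratedDeriv k f (φ z) := by
  rw [iteratedDeriv_mul_comp hU hg hφ hmaps hf i hz]
  simp only [jetMatrix, Matrix.of_apply]
  rw [Fin.sum_univ_eq_sum_range (fun k => jetCoeff g φ i k z * iteratedDeriv k f (φ z))]
  refine Finset.sum_subset (Finset.range_mono (by omega)) fun k _ hk => ?_
  rw [jetCoeff_of_lt (by simpa using hk)]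
  simp

end JetCoeff

lemma ContinuousLinearMap.circleIntegral_comp_comm {E F : Type*} [NormedAddCommGroup E]
    [NormedSpace ℂ E] [CompleteSpace E] [NormedAddCommGroup F] [NormedSpace ℂ F]
    [CompleteSpace F] (L : E →L[ℂ] F) {f : ℂ → E} {c : ℂ} {r : ℝ} (hf : CircleIntegrable f c r) :
    (∮ z in C(c, r), L (f z)) = L (∮ z in C(c, r), f z) := by
  rw [circleIntegral, circleIntegral, ← L.intervalIntegral_comp_comm hf.out]
  simp

/-! ### Functional calculus of the coordinate multiplication -/

section CoordMul

variable {V H : Type*} [NormedAddCommGroup V] [InnerProductSpace ℂ V] [CompleteSpace V]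
  [NormedAddCommGroup H] [InnerProductSpace ℂ H] [CompleteSpace H] [RKHS ℂ H 𝔻 V]
  {T : H →L[ℂ] H}

omit [CompleteSpace H] [CompleteSpace V] in
lemma IsCoordMul.resolvent_apply (hT : IsCoordMul T) {ζ : ℂ} (hζ : ζ ∈ resolventSet ℂ T)
    (z : 𝔻) (f : H) (hne : ζ - z ≠ 0) : (resolvent T ζ f) z = (ζ - z)⁻¹ • f z := by
  have h := congrArg (fun S : H →L[ℂ] H => (S f) z) (Ring.mul_inverse_cancel _ hζ)
  simp only [Algebra.algebraMap_eq_smul_one] at h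
  change ((ζ • (1 : H →L[ℂ] H) - T) (resolvent T ζ f)) z = f z at h
  have h' : (ζ - z) • (resolvent T ζ f) z = f z := by
    rw [← h, sub_smul, ← hT]
    simp
  rw [← h', inv_smul_smul₀ hne]

/-- The Riesz–Dunford calculus of `M_z` gives the operators of multiplication. -/
lemma IsCoordMul.dunford_apply (hT : IsCoordMul T) (hspec : spectrum ℂ T ⊆ Metric.closedBall 0 1)
    {r : ℝ} (hr : 1 < r) {F : ℂ → ℂ} (hF : DifferentiableOn ℂ F (Metric.closedBall 0 r))
    (f : H) (z : 𝔻) : (dunford F r T f) z = F z • f z := by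
  have hres : ∀ ζ ∈ Metric.sphere (0 : ℂ) r, ζ ∈ resolventSet ℂ T := fun ζ hζ => by
    by_contra h
    have h1 := mem_closedBall_zero_iff.1 (hspec h)
    rw [mem_sphere_zero_iff_norm.1 hζ] at h1
    exact absurd h1 (not_le.2 hr)
  have hcont : ContinuousOn (fun ζ => F ζ • resolvent T ζ) (Metric.sphere 0 r) :=
    (hF.continuousOn.mono Metric.sphere_subset_closedBall).smul fun ζ hζ =>
      (spectrum.hasDerivAt_resolvent_const_left (hres ζ hζ)).continuousAt.continuousWithinAt
  -- The bounded map `S ↦ (S f) z` passes through the integral and reduces the claim to Cauchy's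
  -- formula for `F`.
  let L : (H →L[ℂ] H) →L[ℂ] V :=
    ((RKHS.kerFun H z).adjoint).comp (ContinuousLinearMap.apply ℂ H f)
  have hL : ∀ S : H →L[ℂ] H, L S = (S f) z := fun S => by simp [L]
  have hint := L.circleIntegral_comp_comm (hcont.circleIntegrable (by linarith))
  have hne : ∀ ζ ∈ Metric.sphere (0 : ℂ) r, ζ - z ≠ 0 := fun ζ hζ h => by
    rw [sub_eq_zero.1 h, mem_sphere_zero_iff_norm] at hζ
    linarith [z.norm_lt_one]
  have hcongr : (∮ ζ in C(0, r), L (F ζ • resolvent T ζ)) =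
      ∮ ζ in C(0, r), (ζ - z)⁻¹ • (F ζ • f z) := by
    refine circleIntegral.integral_congr (by linarith) fun ζ hζ => ?_
    rw [map_smul, hL, hT.resolvent_apply (hres ζ hζ) z f (hne ζ hζ), smul_comm]
  rw [← hL, dunford, map_smul, ← hint, hcongr,
    (hF.smul_const (f z)).circleIntegral_sub_inv_smul, inv_smul_smul₀]
  · simp [Real.pi_ne_zero]
  · rw [mem_ball_zero_iff]
    linarith [z.norm_lt_one]

end CoordMul

/-! ### Automorphisms of the disc -/

section Mobius

variable {θ : ℝ} {a : ℂ}

lemma one_sub_conj_mul_ne_zero {z : ℂ} (h : ‖a‖ * ‖z‖ < 1) : 1 - conj a * z ≠ 0 := by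
  intro h0
  have h1 : ‖conj a * z‖ = 1 := by rw [← sub_eq_zero.1 h0, norm_one]
  rw [norm_mul, RCLike.norm_conj] at h1
  linarith

lemma differentiableAt_mobius {z : ℂ} (h : ‖a‖ * ‖z‖ < 1) :
    DifferentiableAt ℂ (mobius θ a) z := by
  unfold mobius
  exact (((differentiableAt_id.sub_const a).div
    ((differentiableAt_const _).sub ((differentiableAt_id).const_mul (conj a)))
    (one_sub_conj_mul_ne_zero h))).const_mul _

lemma norm_mul_norm_lt_one (ha : ‖a‖ < 1) {z : ℂ} (hz : ‖z‖ < 1) : ‖a‖ * ‖z‖ < 1 := by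
  nlinarith [norm_nonneg a, norm_nonneg z]

lemma differentiableOn_mobius (ha : ‖a‖ < 1) :
    DifferentiableOn ℂ (mobius θ a) (Metric.ball 0 1) := fun _ hz =>
  (differentiableAt_mobius (norm_mul_norm_lt_one ha
    (mem_ball_zero_iff.1 hz))).differentiableWithinAt

lemma norm_mobius_lt_one (ha : ‖a‖ < 1) {z : ℂ} (hz : ‖z‖ < 1) : ‖mobius θ a z‖ < 1 := by
  have hne := one_sub_conj_mul_ne_zero (norm_mul_norm_lt_one ha hz)
  rw [mobius, norm_mul, Complex.norm_exp_ofReal_mul_I, one_mul, norm_div,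
    div_lt_one (norm_pos_iff.2 hne)]
  refine lt_of_pow_lt_pow_left₀ 2 (norm_nonneg _) ?_
  have hid : ‖1 - conj a * z‖ ^ 2 - ‖z - a‖ ^ 2 = (1 - ‖a‖ ^ 2) * (1 - ‖z‖ ^ 2) := by
    simp only [← Complex.normSq_eq_norm_sq, Complex.normSq_apply, Complex.sub_re,
      Complex.sub_im, Complex.mul_re, Complex.mul_im, Complex.conj_re, Complex.conj_im,
      Complex.one_re, Complex.one_im]
    ring
  have h1 : 0 < 1 - ‖a‖ ^ 2 := by nlinarith [norm_nonneg a]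
  have h2 : 0 < 1 - ‖z‖ ^ 2 := by nlinarith [norm_nonneg z]
  nlinarith [mul_pos h1 h2]

/-- The inverse has the same form, so this one identity yields both sides of bijectivity and, by the
chain rule, a nonvanishing derivative. -/
lemma mobius_neg_mobius (ha : ‖a‖ < 1) {z : ℂ} (hz : ‖z‖ < 1) :
    mobius (-θ) (-(Complex.exp (θ * Complex.I) * a)) (mobius θ a z) = z := by
  have hne := one_sub_conj_mul_ne_zero (norm_mul_norm_lt_one ha hz)
  have hnea := one_sub_conj_mul_ne_zero (norm_mul_norm_lt_one ha ha)
  have hexp : Complex.exp (θ * Complex.I) ≠ 0 := Complex.exp_ne_zero _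
  have hneg : Complex.exp ((-θ : ℝ) * Complex.I) = (Complex.exp (θ * Complex.I))⁻¹ := by
    rw [← Complex.exp_neg]
    push_cast
    ring_nf
  have hconj : conj (Complex.exp (θ * Complex.I)) = (Complex.exp (θ * Complex.I))⁻¹ := by
    rw [← Complex.exp_neg, ← Complex.exp_conj]
    simp
  simp only [mobius, hneg, map_neg, map_mul, hconj]
  generalize Complex.exp (θ * Complex.I) = c at *
  have hne' : 1 - z * conj a ≠ 0 := by rwa [mul_comm]
  have hden : 1 - -(c⁻¹ * conj a) * (c * ((z - a) / (1 - conj a * z))) =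
      (1 - conj a * a) / (1 - conj a * z) := by
    field_simp
    ring
  have hnum : c * ((z - a) / (1 - conj a * z)) - -(c * a) =
      c * (z * (1 - conj a * a)) / (1 - conj a * z) := by
    field_simp
    ring
  rw [hden, hnum]
  field_simp

/-- A biholomorphic automorphism as a permutation of the disc. -/
def mobiusEquiv (θ : ℝ) (a : ℂ) (ha : ‖a‖ < 1) : 𝔻 ≃ 𝔻 where
  toFun z := Complex.UnitDisc.mk (mobius θ a z) (norm_mobius_lt_one ha z.norm_lt_one)
  invFun z := Complex.UnitDisc.mk (mobius (-θ) (-(Complex.exp (θ * Complex.I) * a)) z)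
    (norm_mobius_lt_one (by simpa [Complex.norm_exp_ofReal_mul_I] using ha) z.norm_lt_one)
  left_inv z := by
    apply Complex.UnitDisc.coe_injective
    simpa using mobius_neg_mobius ha z.norm_lt_one
  right_inv z := by
    apply Complex.UnitDisc.coe_injective
    have := mobius_neg_mobius (θ := -θ) (a := -(Complex.exp (θ * Complex.I) * a))
      (by simpa [Complex.norm_exp_ofReal_mul_I] using ha) z.norm_lt_one
    have hexp : Complex.exp (-(θ * Complex.I)) * Complex.exp (θ * Complex.I) = 1 := by
      rw [← Complex.exp_add]
      simp
    simpa [← mul_assoc, hexp] using this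

@[simp]
lemma coe_mobiusEquiv (ha : ‖a‖ < 1) (z : 𝔻) : (mobiusEquiv θ a ha z : ℂ) = mobius θ a z := rfl

lemma deriv_mobius_ne_zero (ha : ‖a‖ < 1) (z : 𝔻) : deriv (mobius θ a) z ≠ 0 := by
  intro h0
  set b := -(Complex.exp (θ * Complex.I) * a)
  have hb : ‖b‖ < 1 := by simpa [b, Complex.norm_exp_ofReal_mul_I] using ha
  have h1 := (differentiableAt_mobius (θ := θ)
    (norm_mul_norm_lt_one ha z.norm_lt_one)).hasDerivAt
  have h2 := (differentiableAt_mobius (θ := -θ)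
    (norm_mul_norm_lt_one hb (norm_mobius_lt_one (θ := θ) ha z.norm_lt_one))).hasDerivAt
  have h3 := h2.comp (z : ℂ) h1
  have h4 : mobius (-θ) b ∘ mobius θ a =ᶠ[nhds (z : ℂ)] id := by
    filter_upwards [z.ball_mem_nhds] with x hx
    exact mobius_neg_mobius ha (mem_ball_zero_iff.1 hx)
  have h5 := h3.deriv
  rw [h4.deriv_eq, h0] at h5
  simp at h5

lemma IsCoordMul.mobiusOp_apply {V H : Type*} [NormedAddCommGroup V] [InnerProductSpace ℂ V]
    [CompleteSpace V] [NormedAddCommGroup H] [InnerProductSpace ℂ H] [CompleteSpace H]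
    [RKHS ℂ H 𝔻 V] {T : H →L[ℂ] H} (hT : IsCoordMul T)
    (hspec : spectrum ℂ T ⊆ Metric.closedBall 0 1) (ha : ‖a‖ < 1) (f : H) (z : 𝔻) :
    (mobiusOp θ a T f) z = (mobiusEquiv θ a ha z : ℂ) • f z := by
  have hpos : 0 < 1 + ‖a‖ := by positivity
  refine hT.dunford_apply hspec ?_ (fun ζ hζ => ?_) f z
  · rw [one_lt_div hpos]
    linarith
  · refine (differentiableAt_mobius ?_).differentiableWithinAt
    refine (mul_le_mul_of_nonneg_left (mem_closedBall_zero_iff.1 hζ) (norm_nonneg a)).trans_lt ?_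
    rw [mul_div_assoc', div_lt_one hpos]
    linarith

end Mobius

/-! ### Sharpness turns intertwiners into weighted compositions -/

section Sharp

variable {K : ℂ → ℂ → ℂ} {H : Type*} [NormedAddCommGroup H] [InnerProductSpace ℂ H]
  [CompleteSpace H] [RKHS ℂ H 𝔻 ℂ]

lemma HasScalarKernel.kerFun_ne_zero (hpos : PosDefKernel K) (hker : HasScalarKernel H K)
    (w : 𝔻) : RKHS.kerFun H w 1 ≠ 0 := by
  intro h0
  have h1 := hker.kerFun_apply w w 1
  have h2 : 0 < K w w := by simpa using hpos.diag_pos (i := w)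
  rw [h0] at h1
  simp only [RKHS.coe_zero, Pi.zero_apply, mul_one] at h1
  exact h2.ne h1

/-- For a sharp kernel with `M_z` weakly homogeneous, the intertwining operators are invertible
weighted composition operators: their adjoints permute the lines spanned by kernel functions. -/
lemma HasScalarKernel.exists_weight (hpos : PosDefKernel K) (hker : HasScalarKernel H K)
    (hsharp : IsSharp H) (hweak : CoordMulWeaklyHomogeneous H) (θ : ℝ) {a : ℂ} (ha : ‖a‖ < 1) :
    ∃ (S S' : H →L[ℂ] H) (c : 𝔻 → ℂ), S * S' = 1 ∧ S' * S = 1 ∧ ∀ w, c w ≠ 0 ∧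
      S (RKHS.kerFun H w 1) = c w • RKHS.kerFun H (mobiusEquiv θ a ha w) 1 := by
  obtain ⟨T, hT, hspec, hhom⟩ := hweak
  obtain ⟨T', hT', hsharp⟩ := hsharp
  obtain rfl : T' = T := by
    ext f z
    rw [hT, hT']
  obtain ⟨L, hL⟩ := hhom θ a ha
  set N : H →L[ℂ] H := ((L⁻¹ : (H →L[ℂ] H)ˣ) : H →L[ℂ] H)
  have hinter : mobiusOp θ a T' * N = N * T' := by
    conv_rhs => rw [← hL, ← mul_assoc, ← mul_assoc, Units.inv_mul, one_mul]
  have hNL : star (N : H →L[ℂ] H) * star (L : H →L[ℂ] H) = 1 := by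
    rw [← star_mul, Units.mul_inv, star_one]
  have hLN : star (L : H →L[ℂ] H) * star (N : H →L[ℂ] H) = 1 := by
    rw [← star_mul, Units.inv_mul, star_one]
  have hline : ∀ w, ∃ c : ℂ, star N (RKHS.kerFun H w 1) =
      c • RKHS.kerFun H (mobiusEquiv θ a ha w) 1 := fun w => by
    set u := mobiusEquiv θ a ha w with hu
    -- Tested against `f`, membership reads `(N (T' f)) w = φ(w) (N f) w`, which is the intertwining
    -- relation evaluated at `w`.
    have hmem : star N (RKHS.kerFun H w 1) ∈ LinearMap.ker
        ((ContinuousLinearMap.adjoint T' - conj (u : ℂ) • ContinuousLinearMap.id ℂ H :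
          H →L[ℂ] H) : H →ₗ[ℂ] H) := by
      rw [LinearMap.mem_ker]
      refine ext_inner_right ℂ fun f => ?_
      have h1 : (N (T' f)) w = (u : ℂ) * (N f) w := by
        have := congrArg (fun S : H →L[ℂ] H => (S f) w) hinter
        change (mobiusOp θ a T' (N f)) w = (N (T' f)) w at this
        rw [← this, hT'.mobiusOp_apply hspec ha, smul_eq_mul]
      simp only [ContinuousLinearMap.star_eq_adjoint, ContinuousLinearMap.coe_coe, sub_apply,
        smul_apply, ContinuousLinearMap.id_apply, inner_sub_left, inner_smul_left,
        ContinuousLinearMap.adjoint_inner_left, RKHS.kerFun_inner, inner_zero_left]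
      rw [h1]
      simp [mul_comm]
    rw [hsharp u] at hmem
    have hspan : Submodule.span ℂ (Set.range (RKHS.kerFun H u)) =
        Submodule.span ℂ {RKHS.kerFun H u 1} := by
      apply le_antisymm
      · rw [Submodule.span_le]
        rintro _ ⟨v, rfl⟩
        refine Submodule.mem_span_singleton.2 ⟨v, ?_⟩
        rw [← map_smul, smul_eq_mul, mul_one]
      · exact Submodule.span_mono (by simp)
    rw [hspan, IsClosed.submodule_topologicalClosure_eq
      (Submodule.closed_of_finiteDimensional _)] at hmem
    obtain ⟨c, hc⟩ := Submodule.mem_span_singleton.1 hmem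
    exact ⟨c, hc.symm⟩
  choose c hc using hline
  refine ⟨star N, star (L : H →L[ℂ] H), c, hNL, hLN, fun w => ⟨fun h0 => ?_, hc w⟩⟩
  have h1 := congrArg (fun x => star (L : H →L[ℂ] H) x) (hc w)
  simp only [h0, zero_smul, map_zero] at h1
  have h2 := congrArg (fun S : H →L[ℂ] H => S (RKHS.kerFun H w 1)) hLN
  exact hker.kerFun_ne_zero hpos w (h2.symm.trans h1)

/-- The weight of a weighted composition operator is holomorphic. -/
lemma HasScalarKernel.differentiableOn_weight (hK : SesquiAnalytic K) (hpos : PosDefKernel K)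
    (hker : HasScalarKernel H K) {θ : ℝ} {a : ℂ} (ha : ‖a‖ < 1) {S : H →L[ℂ] H} {c : 𝔻 → ℂ}
    (hS : ∀ w, S (RKHS.kerFun H w 1) = c w • RKHS.kerFun H (mobiusEquiv θ a ha w) 1) :
    DifferentiableOn ℂ (discExt fun w => conj (c w)) (Metric.ball 0 1) ∧
      ∀ (f : H), ∀ z ∈ Metric.ball (0 : ℂ) 1, discExt (S.adjoint f) z =
        discExt (fun w => conj (c w)) z * discExt f (mobius θ a z) := by
  have heq : ∀ (f : H), ∀ z ∈ Metric.ball (0 : ℂ) 1, discExt (S.adjoint f) z =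
      discExt (fun w => conj (c w)) z * discExt f (mobius θ a z) := fun f z hz => by
    lift z to 𝔻 using mem_ball_zero_iff.1 hz
    rw [← coe_mobiusEquiv ha, discExt_coe, discExt_coe, discExt_coe]
    have h1 : ⟪RKHS.kerFun H z 1, S.adjoint f⟫_ℂ = (S.adjoint f) z := by simp
    rw [← h1, ContinuousLinearMap.adjoint_inner_right, hS, inner_smul_left]
    simp
  refine ⟨fun z hz => ?_, heq⟩
  lift z to 𝔻 using mem_ball_zero_iff.1 hz
  -- Near `z` the weight is the quotient of `S.adjoint k` by `k ∘ φ`; the denominator at `z` is `K(φ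
  -- z, φ z) > 0`.
  set k := RKHS.kerFun H (mobiusEquiv θ a ha z) 1
  have hφ : Set.MapsTo (mobius θ a) (Metric.ball 0 1) (Metric.ball 0 1) := fun x hx =>
    mem_ball_zero_iff.2 (norm_mobius_lt_one ha (mem_ball_zero_iff.1 hx))
  have hden := ((hker.differentiableOn hK k).comp (differentiableOn_mobius (θ := θ) ha) hφ)
  have hne : discExt k (mobius θ a z) ≠ 0 := by
    have h2 : 0 < K (mobiusEquiv θ a ha z) (mobiusEquiv θ a ha z) := by
      simpa using hpos.diag_pos (i := mobiusEquiv θ a ha z)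
    rw [← coe_mobiusEquiv ha, discExt_coe, hker.kerFun_apply, mul_one]
    exact h2.ne'
  have hden' := hden.differentiableAt z.ball_mem_nhds
  have hnum := (hker.differentiableOn hK (S.adjoint k)).differentiableAt z.ball_mem_nhds
  refine ((hnum.div hden' hne).congr_of_eventuallyEq ?_).differentiableWithinAt
  filter_upwards [z.ball_mem_nhds, hden'.continuousAt.eventually_ne hne] with x hx hx0
  rw [Pi.div_apply, heq k x hx]
  exact (mul_div_cancel_right₀ _ hx0).symm

/-- A weighted composition operator acts on jet evaluations by invertible matrices. -/
lemma HasScalarKernel.exists_jet_weight (hK : SesquiAnalytic K) (hpos : PosDefKernel K)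
    (hker : HasScalarKernel H K) (hsharp : IsSharp H) (hweak : CoordMulWeaklyHomogeneous H)
    {e : 𝔻 → ℕ → H} (he : ∀ w j (f : H), ⟪e w j, f⟫_ℂ = iteratedDeriv j (discExt f) w)
    (θ : ℝ) {a : ℂ} (ha : ‖a‖ < 1) (n : ℕ) :
    ∃ (S S' : H →L[ℂ] H) (D : 𝔻 → Matrix (Fin (n + 1)) (Fin (n + 1)) ℂ),
      S * S' = 1 ∧ S' * S = 1 ∧ ∀ w, IsUnit (D w).det ∧
        ∀ j : Fin (n + 1), S (e w j) = ∑ l, D w j l • e (mobiusEquiv θ a ha w) l := by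
  obtain ⟨S, S', c, hSS', hS'S, hc⟩ := hker.exists_weight hpos hsharp hweak θ ha
  obtain ⟨hg, hadj⟩ := hker.differentiableOn_weight hK hpos ha fun w => (hc w).2
  set g := discExt fun w => conj (c w)
  have hφ : Set.MapsTo (mobius θ a) (Metric.ball 0 1) (Metric.ball 0 1) := fun x hx =>
    mem_ball_zero_iff.2 (norm_mobius_lt_one ha (mem_ball_zero_iff.1 hx))
  -- The entries are conjugated because `e w j` stands in the conjugate-linear slot of the inner
  -- product.
  refine ⟨S, S', fun w => (jetMatrix g (mobius θ a) n w).map conj, hSS', hS'S,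
    fun w => ⟨?_, fun j => ?_⟩⟩
  · have h := isUnit_det_jetMatrix (g := g) (φ := mobius θ a) (z := (w : ℂ)) (n := n)
      (by simpa [g] using (hc w).1) (deriv_mobius_ne_zero ha w)
    have h' := h.map (starRingEnd ℂ)
    rwa [RingHom.map_det] at h'
  · refine ext_inner_right ℂ fun f => ?_
    rw [← ContinuousLinearMap.adjoint_inner_right, he, sum_inner]
    have h1 : discExt (S.adjoint f) =ᶠ[nhds (w : ℂ)] fun x => g x * discExt f (mobius θ a x) := by
      filter_upwards [w.ball_mem_nhds] with x hx using hadj f x hx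
    rw [h1.iteratedDeriv_eq, iteratedDeriv_mul_comp_eq_jetMatrix Metric.isOpen_ball hg
      (differentiableOn_mobius ha) hφ (hker.differentiableOn hK f) j w.coe_mem_ball]
    refine Finset.sum_congr rfl fun l _ => ?_
    rw [inner_smul_left, he]
    simp

end Sharp

/-! ### Transport of operators to a product kernel -/

section Transport

variable {X ι E F H : Type*} [Fintype ι] [NormedAddCommGroup E] [InnerProductSpace ℂ E]
  [NormedAddCommGroup F] [InnerProductSpace ℂ F] [NormedAddCommGroup H] [InnerProductSpace ℂ H]

/-- This is `S₁ ⊗ S₂` restricted to the closed span of the vectors `k₁ z ⊗ k₂ z i`: the proposed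
images have as Gram matrix the Schur product of those of `S₁ k₁` and `S₂ k₂`. -/
lemma exists_clm_transport [CompleteSpace H] {k₁ : X → E} {k₂ : X → ι → F} {k : X → ι → H}
    (hdense : (Submodule.span ℂ (Set.range fun p : X × ι => k p.1 p.2)).topologicalClosure = ⊤)
    (hk : ∀ z i w j, ⟪k z i, k w j⟫_ℂ = ⟪k₁ z, k₁ w⟫_ℂ * ⟪k₂ z i, k₂ w j⟫_ℂ)
    {φ : X → X} {S₁ : E →L[ℂ] E} {S₂ : F →L[ℂ] F} {c : X → ℂ} {D : X → Matrix ι ι ℂ}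
    (h₁ : ∀ w, S₁ (k₁ w) = c w • k₁ (φ w))
    (h₂ : ∀ w j, S₂ (k₂ w j) = ∑ l, D w j l • k₂ (φ w) l) :
    ∃ S : H →L[ℂ] H, ∀ w j, S (k w j) = ∑ l, (c w * D w j l) • k (φ w) l := by
  obtain ⟨S, hS⟩ := exists_clm_of_gram_hadamard (k := fun p : X × ι => k p.1 p.2)
    (k' := fun p => ∑ l, (c p.1 * D p.1 p.2 l) • k (φ p.1) l) (k₁ := fun p => k₁ p.1)
    (k₂ := fun p => k₂ p.1 p.2) hdense (fun p q => hk _ _ _ _) S₁ S₂ fun p q => by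
      simp only [h₁, h₂, sum_inner, inner_sum, inner_smul_left, inner_smul_right, hk,
        Finset.mul_sum, map_mul]
      refine Finset.sum_congr rfl fun i _ => Finset.sum_congr rfl fun j _ => ?_
      ring
  exact ⟨S, fun w j => hS (w, j)⟩

variable [DecidableEq ι]

lemma sum_mul_smul_sum {D D' : Matrix ι ι ℂ} (h : D' * D = 1) (y : ι → H) (j : ι) :
    ∑ l, D' j l • ∑ m, D l m • y m = y j := by
  simp only [Finset.smul_sum, smul_smul]
  rw [Finset.sum_comm]
  simp only [← Finset.sum_smul, ← Matrix.mul_apply, h, Matrix.one_apply, ite_smul, one_smul,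
    zero_smul, Finset.sum_ite_eq, Finset.mem_univ, if_true]

/-- Two invertible operators acting compatibly on `k₁` and `k₂` induce an invertible operator. -/
lemma exists_clm_transport_unit [CompleteSpace H] {k₁ : X → E} {k₂ : X → ι → F} {k : X → ι → H}
    (hdense : (Submodule.span ℂ (Set.range fun p : X × ι => k p.1 p.2)).topologicalClosure = ⊤)
    (hk : ∀ z i w j, ⟪k z i, k w j⟫_ℂ = ⟪k₁ z, k₁ w⟫_ℂ * ⟪k₂ z i, k₂ w j⟫_ℂ)
    (φ : X ≃ X) {S₁ S₁' : E →L[ℂ] E} {S₂ S₂' : F →L[ℂ] F} {c : X → ℂ} {D : X → Matrix ι ι ℂ}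
    (hS₁ : S₁' * S₁ = 1) (hS₂ : S₂' * S₂ = 1) (hc : ∀ w, c w ≠ 0) (hD : ∀ w, IsUnit (D w).det)
    (h₁ : ∀ w, S₁ (k₁ w) = c w • k₁ (φ w))
    (h₂ : ∀ w j, S₂ (k₂ w j) = ∑ l, D w j l • k₂ (φ w) l) :
    ∃ S S' : H →L[ℂ] H, S * S' = 1 ∧ S' * S = 1 ∧
      ∀ w j, S (k w j) = ∑ l, (c w * D w j l) • k (φ w) l := by
  obtain ⟨S, hS⟩ := exists_clm_transport hdense hk h₁ h₂
  have hS₁x : ∀ x, S₁' (S₁ x) = x := fun x => congrArg (fun A : E →L[ℂ] E => A x) hS₁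
  have hS₂x : ∀ x, S₂' (S₂ x) = x := fun x => congrArg (fun A : F →L[ℂ] F => A x) hS₂
  -- The inverses act in the same way over `φ.symm`, with inverted coefficients, so they transport
  -- as well.
  have h₁' : ∀ w, S₁' (k₁ w) = (c (φ.symm w))⁻¹ • k₁ (φ.symm w) := fun w => by
    rw [← hS₁x (k₁ (φ.symm w)), h₁, φ.apply_symm_apply, map_smul,
      inv_smul_smul₀ (hc _)]
  have h₂' : ∀ w j, S₂' (k₂ w j) = ∑ l, (D (φ.symm w))⁻¹ j l • k₂ (φ.symm w) l := fun w j => by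
    have h := sum_mul_smul_sum (Matrix.nonsing_inv_mul _ (hD (φ.symm w))) (k₂ w) j
    have h' : ∀ l, ∑ m, D (φ.symm w) l m • k₂ w m = S₂ (k₂ (φ.symm w) l) := fun l => by
      rw [h₂, φ.apply_symm_apply]
    simp only [h'] at h
    rw [← h, map_sum]
    simp only [map_smul, hS₂x]
  obtain ⟨S', hS'⟩ := exists_clm_transport hdense hk h₁' h₂'
  have hext : ∀ A : H →L[ℂ] H, (∀ w j, A (k w j) = k w j) → A = 1 := fun A hA =>
    ContinuousLinearMap.ext_on (Submodule.dense_iff_topologicalClosure_eq_top.2 hdense)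
      (by rintro _ ⟨p, rfl⟩; exact hA _ _)
  refine ⟨S, S', hext _ fun w j => ?_, hext _ fun w j => ?_, hS⟩
  · change S (S' (k w j)) = k w j
    rw [hS', map_sum, ← sum_mul_smul_sum (Matrix.nonsing_inv_mul _ (hD (φ.symm w))) (k w) j]
    refine Finset.sum_congr rfl fun l _ => ?_
    rw [map_smul, hS, φ.apply_symm_apply, Finset.smul_sum, Finset.smul_sum]
    refine Finset.sum_congr rfl fun m _ => ?_
    rw [smul_smul, smul_smul]
    congr 1
    field_simp [hc (φ.symm w)]
  · change S' (S (k w j)) = k w j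
    rw [hS, map_sum, ← sum_mul_smul_sum (Matrix.mul_nonsing_inv _ (hD w)) (k w) j]
    refine Finset.sum_congr rfl fun l _ => ?_
    rw [map_smul, hS', φ.symm_apply_apply, Finset.smul_sum, Finset.smul_sum]
    refine Finset.sum_congr rfl fun m _ => ?_
    rw [smul_smul, smul_smul]
    congr 1
    field_simp [hc w]

end Transport

/-! ### Coordinate multiplication on the product space -/

section MatrixKernel

variable {m : ℕ} {H : Type*} [NormedAddCommGroup H] [InnerProductSpace ℂ H] [CompleteSpace H]
  [RKHS ℂ H 𝔻 (EuclideanSpace ℂ (Fin m))]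

variable (H) in
/-- The kernel vectors `K(·, w) e_j`. -/
def kerVec (w : 𝔻) (j : Fin m) : H :=
  RKHS.kerFun H w (EuclideanSpace.single j 1)

lemma inner_kerVec (w : 𝔻) (j : Fin m) (f : H) : ⟪kerVec H w j, f⟫_ℂ = f w j := by
  simp [kerVec, EuclideanSpace.inner_single_left]

variable (H) in
lemma span_kerVec_topologicalClosure : (Submodule.span ℂ
    (Set.range fun p : 𝔻 × Fin m => kerVec H p.1 p.2)).topologicalClosure = ⊤ := by
  rw [← top_le_iff, ← RKHS.kerFun_dense H]
  refine Submodule.topologicalClosure_mono (Submodule.span_le.2 ?_)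
  rintro _ ⟨w, v, rfl⟩
  have hv : v = ∑ j, v j • EuclideanSpace.single j (1 : ℂ) := by
    ext i
    simp [Finset.sum_apply, Pi.single_apply]
  rw [hv, map_sum]
  refine Submodule.sum_mem _ fun j _ => ?_
  rw [map_smul]
  exact Submodule.smul_mem _ _ (Submodule.subset_span ⟨(w, j), rfl⟩)

lemma HasMatrixKernel.inner_kerVec_kerVec {K : ℂ → ℂ → Matrix (Fin m) (Fin m) ℂ}
    (hker : HasMatrixKernel H K) (z w : 𝔻) (i j : Fin m) :
    ⟪kerVec H z i, kerVec H w j⟫_ℂ = K z w i j := by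
  rw [inner_kerVec, kerVec, RKHS.kerFun_apply, hker]
  simp [Matrix.ofLp_toEuclideanCLM]

variable {H₁ F : Type*} [NormedAddCommGroup H₁] [InnerProductSpace ℂ H₁] [CompleteSpace H₁]
  [RKHS ℂ H₁ 𝔻 ℂ] [NormedAddCommGroup F] [InnerProductSpace ℂ F]
  {k₂ : 𝔻 → Fin m → F}

/-- Multipliers of the first factor act on the space of the product kernel. -/
lemma exists_multiplier
    (hk : ∀ z i w j, ⟪kerVec H z i, kerVec H w j⟫_ℂ =
      ⟪RKHS.kerFun H₁ z 1, RKHS.kerFun H₁ w 1⟫_ℂ * ⟪k₂ z i, k₂ w j⟫_ℂ)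
    {M₁ : H₁ →L[ℂ] H₁} {q : 𝔻 → ℂ} (hM : ∀ f z, (M₁ f) z = q z * f z) :
    ∃ M : H →L[ℂ] H, ∀ f z, (M f) z = q z • f z := by
  -- Kernel vectors are eigenvectors of the adjoint of a multiplier; transport applies with the
  -- identity as point map and identity matrices.
  have h₁ : ∀ w, M₁.adjoint (RKHS.kerFun H₁ w 1) = conj (q w) • RKHS.kerFun H₁ (id w) 1 :=
    fun w => ext_inner_right ℂ fun f => by
      rw [ContinuousLinearMap.adjoint_inner_left, RKHS.kerFun_inner, hM, inner_smul_left, id,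
        RKHS.kerFun_inner]
      simp [mul_comm]
  have h₂ : ∀ w j, ContinuousLinearMap.id ℂ F (k₂ w j) =
      ∑ l, (1 : Matrix (Fin m) (Fin m) ℂ) j l • k₂ (id w) l := fun w j => by
    simp [Matrix.one_apply]
  obtain ⟨S, hS⟩ := exists_clm_transport (span_kerVec_topologicalClosure H) hk h₁ h₂
  refine ⟨S.adjoint, fun f z => ?_⟩
  ext i
  rw [← inner_kerVec, ContinuousLinearMap.adjoint_inner_right, hS]
  simp [Matrix.one_apply, inner_smul_left, inner_kerVec]

lemma coordMulWeaklyHomogeneous_of_product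
    (hk : ∀ z i w j, ⟪kerVec H z i, kerVec H w j⟫_ℂ =
      ⟪RKHS.kerFun H₁ z 1, RKHS.kerFun H₁ w 1⟫_ℂ * ⟪k₂ z i, k₂ w j⟫_ℂ)
    (hweak : CoordMulWeaklyHomogeneous H₁)
    (hunit : ∀ (θ : ℝ) (a : ℂ) (ha : ‖a‖ < 1), ∃ (S S' : H →L[ℂ] H)
      (D : 𝔻 → Matrix (Fin m) (Fin m) ℂ), S * S' = 1 ∧ S' * S = 1 ∧
      ∀ w j, S (kerVec H w j) = ∑ l, D w j l • kerVec H (mobiusEquiv θ a ha w) l) :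
    CoordMulWeaklyHomogeneous H := by
  obtain ⟨T₁, hT₁, hspec, -⟩ := hweak
  obtain ⟨T, hT⟩ := exists_multiplier hk (M₁ := T₁) (q := fun z => (z : ℂ)) hT₁
  have hspecT : spectrum ℂ T ⊆ Metric.closedBall 0 1 := by
    intro ζ hζ
    by_contra hn
    have hres : ζ ∈ resolventSet ℂ T₁ := by
      by_contra h
      exact hn (hspec h)
    rw [mem_closedBall_zero_iff, not_le] at hn
    have hne : ∀ z : 𝔻, ζ - z ≠ 0 := fun z h => by
      rw [sub_eq_zero.1 h] at hn
      exact absurd z.norm_lt_one hn.not_gt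
    -- The resolvent of `T₁` multiplies by `(ζ - z)⁻¹`; its transport inverts `ζ - T`.
    obtain ⟨R, hR⟩ := exists_multiplier hk (M₁ := resolvent T₁ ζ) (q := fun z => (ζ - z)⁻¹)
      fun f z => hT₁.resolvent_apply hres z f (hne z)
    refine hζ (isUnit_iff_exists.2 ⟨R, ?_, ?_⟩)
    · ext f z : 2
      change ((algebraMap ℂ (H →L[ℂ] H) ζ - T) (R f)) z = f z
      simp only [Algebra.algebraMap_eq_smul_one, sub_apply, smul_apply,
        one_apply_eq_self, RKHS.coe_sub, RKHS.coe_smul, Pi.sub_apply, Pi.smul_apply,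
        hT]
      rw [← sub_smul, hR, smul_inv_smul₀ (hne z)]
    · ext f z : 2
      change (R ((algebraMap ℂ (H →L[ℂ] H) ζ - T) f)) z = f z
      rw [hR]
      simp only [Algebra.algebraMap_eq_smul_one, sub_apply, smul_apply,
        one_apply_eq_self, RKHS.coe_sub, RKHS.coe_smul, Pi.sub_apply, Pi.smul_apply,
        hT]
      rw [← sub_smul, inv_smul_smul₀ (hne z)]
  refine ⟨T, hT, hspecT, fun θ a ha => ?_⟩
  obtain ⟨S, S', D, hSS', hS'S, hS⟩ := hunit θ a ha
  have hN1 : star S * star S' = 1 := by rw [← star_mul, hS'S, star_one]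
  have hN2 : star S' * star S = 1 := by rw [← star_mul, hSS', star_one]
  have hNapply : ∀ f z i, ((star S) f) z i =
      ∑ l, conj (D z i l) * f (mobiusEquiv θ a ha z) l := fun f z i => by
    rw [← inner_kerVec, ContinuousLinearMap.star_eq_adjoint,
      ContinuousLinearMap.adjoint_inner_right, hS, sum_inner]
    simp only [inner_smul_left, inner_kerVec]
  -- `star S` sends `f` to a matrix weight times `f ∘ φ`, so multiplying first by `z` gives
  -- multiplication by `φ(z)` afterwards.
  have hinter : mobiusOp θ a T * star S = star S * T := by
    ext f z i
    change (mobiusOp θ a T (star S f)) z i = ((star S) (T f)) z i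
    rw [IsCoordMul.mobiusOp_apply hT hspecT ha, hNapply]
    simp only [hT, PiLp.smul_apply, smul_eq_mul, hNapply, Finset.mul_sum]
    exact Finset.sum_congr rfl fun l _ => by ring
  refine ⟨⟨star S', star S, hN2, hN1⟩, ?_⟩
  change star S' * mobiusOp θ a T * star S = T
  rw [mul_assoc, hinter, ← mul_assoc, hN2, one_mul]

end MatrixKernel

/-! ### The jet kernel as a product kernel -/

theorem mainTheorem3
    (K₁ K₂ : ℂ → ℂ → ℂ)
    (hK₁ : SesquiAnalytic K₁) (hK₂ : SesquiAnalytic K₂)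
    (hpos₁ : PosDefKernel K₁) (hpos₂ : PosDefKernel K₂)
    {H₁ : Type*} [NormedAddCommGroup H₁] [InnerProductSpace ℂ H₁] [CompleteSpace H₁]
    [RKHS ℂ H₁ 𝔻 ℂ] (hker₁ : HasScalarKernel H₁ K₁)
    {H₂ : Type*} [NormedAddCommGroup H₂] [InnerProductSpace ℂ H₂] [CompleteSpace H₂]
    [RKHS ℂ H₂ 𝔻 ℂ] (hker₂ : HasScalarKernel H₂ K₂)
    (hsharp₁ : IsSharp H₁) (hsharp₂ : IsSharp H₂)
    (hweak₁ : CoordMulWeaklyHomogeneous H₁) (hweak₂ : CoordMulWeaklyHomogeneous H₂)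
    (n : ℕ) :
    NonnegDefKernel (jetKernel n K₁ K₂) ∧
      ∀ (H : Type*) [NormedAddCommGroup H] [InnerProductSpace ℂ H] [CompleteSpace H]
        [RKHS ℂ H 𝔻 (EuclideanSpace ℂ (Fin (n + 1)))],
        HasMatrixKernel H (jetKernel n K₁ K₂) → CoordMulWeaklyHomogeneous H := by
  choose e he using fun w j => hker₂.exists_inner_eq_iteratedDeriv hK₂ w j
  have hjet : ∀ (z w : 𝔻) (i j : Fin (n + 1)), jetKernel n K₁ K₂ z w i j =
      ⟪RKHS.kerFun H₁ z 1, RKHS.kerFun H₁ w 1⟫_ℂ * ⟪e z i, e w j⟫_ℂ := fun z w i j => by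
    rw [← hker₂.iteratedDeriv_antiDeriv he, RKHS.kerFun_inner, hker₁.kerFun_apply]
    simp [jetKernel]
  refine ⟨?_, fun H _ _ _ _ hker => ?_⟩
  · unfold NonnegDefKernel
    simp only [hjet]
    exact gram_hadamard_posSemidef (fun p : 𝔻 × Fin (n + 1) => RKHS.kerFun H₁ p.1 1)
      fun p : 𝔻 × Fin (n + 1) => e p.1 p.2
  · have hk : ∀ z i w j, ⟪kerVec H z i, kerVec H w j⟫_ℂ =
        ⟪RKHS.kerFun H₁ z 1, RKHS.kerFun H₁ w 1⟫_ℂ * ⟪e z i, e w j⟫_ℂ := fun z i w j => by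
      rw [hker.inner_kerVec_kerVec, hjet]
    refine coordMulWeaklyHomogeneous_of_product
      (k₂ := fun (w : 𝔻) (j : Fin (n + 1)) => e w j) hk hweak₁ fun θ a ha => ?_
    obtain ⟨S₁, S₁', c, -, hS₁, hc⟩ := hker₁.exists_weight hpos₁ hsharp₁ hweak₁ θ ha
    obtain ⟨S₂, S₂', D, -, hS₂, hD⟩ :=
      hker₂.exists_jet_weight hK₂ hpos₂ hsharp₂ hweak₂ he θ ha n
    obtain ⟨S, S', h1, h2, hS⟩ := exists_clm_transport_unit
      (k₂ := fun (w : 𝔻) (j : Fin (n + 1)) => e w j) (span_kerVec_topologicalClosure H) hk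
      (mobiusEquiv θ a ha) hS₁ hS₂ (fun w => (hc w).1) (fun w => (hD w).1)
      (fun w => (hc w).2) fun w j => (hD w).2 j
    exact ⟨S, S', fun w => Matrix.of fun j l => c w * D w j l, h1, h2, hS⟩

end
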